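/- Let $\mathbb F$ be a finite field and let $n,k,\delta$ be integers with $1\le k<n$, $\delta\ge 0$ and $(n-k)\mid\delta$. Put $\nu=\delta/(n-k)$ and $L=\lfloor \delta/k\rfloor+\delta/(n-k)$. Let $H(z)=\sum_{i=0}^{\nu}H_iz^i$ with $H_i\in\mathbb F^{(n-k)\times n}$, set $H_i=0$ for $i>\nu$, and let $$H_L^c=\begin{pmatrix}H_0&&&\\ H_1&H_0&&\\ \vdots&\vdots&\ddots&\\ H_L&H_{L-1}&\cdots&H_0\end{pmatrix}\in\mathbb F^{(L+1)(n-k)\times(L+1)n}.$$ Suppose that every full-size minor of $H_L^c$ that is not trivially zero is nonzero, that is, every minor formed by columns with indices $1\le t_1<\dots<t_{(L+1)(n-k)}\le (L+1)n$ such that $t_{s(n-k)}\le sn$ for $s=1,\dots,L$ is nonzero. Then $H(z)$ is left prime, i.e. whenever $H(z)=M(z)\bar H(z)$ with $M(z)\in\mathbb F[z]^{(n-k)\times(n-k)}$ and $\bar H(z)\in\mathbb F[z]^{(n-k)\times n}$, the matrix $M(z)$ is invertible over $\mathbb F[z]$. Moreover, $H(z)$ is a parity-check matrix of an $(n,k,\delta)$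 maximum distance profile (MDP) convolutional code $\mathcal C$, and the degree $\delta$ of $\mathcal C$ equals the sum of the row degrees of $H(z)$ (the $i$-th row degree is the largest degree of an entry of row $i$). Here an $(n,k,\delta)$ convolutional code is a submodule $\mathcal C\subseteq\mathbb F[z]^n$ of rank $k$ whose degree, the highest degree of the $k\times k$ minors of a matrix $G(z)\in\mathbb F[z]^{k\times n}$ whose rows form a basis of $\mathcal C$, is $\delta$. The matrix $H(z)$ is a parity-check matrix of $\mathcal C$ if for all $c(z)\in\mathbb F[z]^n$ one has $c(z)\in\mathcal C\Leftrightarrow H(z)c(z)^\top=0$. The $j$-th column distance of $\mathcal C$ is $$d_j^c=\min\Big\{\sum_{i=0}^{j}\mathrm{wt}(v_i)\ \Big|\ v(z)=\sum_i v_iz^i\in\mathcal C,\ v_0\neq0\Big\},$$ where $\mathrm{wt}$ is the Hamming weight on $\mathbb F^n$, and $\mathcal C$ is MDP if $d_j^c=(n-k)(j+1)+1$ for all $j=0,\dots,\lfloor\delta/k\rfloor+\lfloor\delta/(n-k)\rfloor$. -/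

import Mathlib

namespace ConvCode

open Polynomial

variable {F : Type*} [Field F]

/-- `H(z)` is left prime: in every factorization `H = M * H'` with `M` square, the left factor
`M` is unimodular. -/
def IsLeftPrime {m n : ℕ} (H : Matrix (Fin m) (Fin n) F[X]) : Prop :=
  ∀ (M : Matrix (Fin m) (Fin m) F[X]) (H' : Matrix (Fin m) (Fin n) F[X]), H = M * H' → IsUnit M

/-- The largest degree among the entries of the `i`-th row. -/
def rowDegree {m n : ℕ} (H : Matrix (Fin m) (Fin n) F[X]) (i : Fin m) : ℕ :=
  Finset.univ.sup fun l => (H i l).natDegree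

/-- The `j`-th truncated sliding parity-check matrix `H_j^c`, of size `(j+1)m × (j+1)n`: its block
in block row `a` and block column `b` is the coefficient matrix `H_{a-b}` if `b ≤ a`,
and `0` otherwise. -/
def slidingParityCheck {m n : ℕ} (H : Matrix (Fin m) (Fin n) F[X]) (j : ℕ) :
    Matrix (Fin ((j + 1) * m)) (Fin ((j + 1) * n)) F :=
  Matrix.of fun a b =>
    if (b.divNat : ℕ) ≤ (a.divNat : ℕ) then
      (H a.modNat b.modNat).coeff ((a.divNat : ℕ) - (b.divNat : ℕ))
    else 0

/-- The selection of columns of `H_j^c` with one-based indices `t_1 < t_2 < ⋯ < t_{(j+1)m}`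
gives a minor that is not trivially zero: `t_{s m} ≤ s n` for `s = 1, …, j`.
In the code both rows and columns are counted from `0`. -/
def NotTriviallyZero {m n j : ℕ} (t : Fin ((j + 1) * m) ↪o Fin ((j + 1) * n)) : Prop :=
  ∀ s : ℕ, 1 ≤ s → s ≤ j → ∀ i : Fin ((j + 1) * m), (i : ℕ) + 1 = s * m → (t i : ℕ) + 1 ≤ s * n

/-- Every full-size minor of `H_j^c` that is not trivially zero is nonzero. -/
def MinorCriterion {m n : ℕ} (H : Matrix (Fin m) (Fin n) F[X]) (j : ℕ) : Prop :=
  ∀ t : Fin ((j + 1) * m) ↪o Fin ((j + 1) * n), NotTriviallyZero t →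
    ((slidingParityCheck H j).submatrix id t).det ≠ 0

/-- The rows of `G(z)` form a basis of the code `C`. -/
def IsGeneratorMatrix {k n : ℕ} (G : Matrix (Fin k) (Fin n) F[X])
    (C : Submodule F[X] (Fin n → F[X])) : Prop :=
  LinearIndependent F[X] (fun i => G i) ∧ Submodule.span F[X] (Set.range fun i => G i) = C

/-- The highest degree of the full-size minors of `G(z)`. -/
noncomputable def maxMinorDegree {k n : ℕ} (G : Matrix (Fin k) (Fin n) F[X]) : ℕ :=
  Finset.univ.sup fun t : Fin k ↪o Fin n => (G.submatrix id t).det.natDegree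

/-- `C` is an `(n, k, δ)` convolutional code: a submodule of `F[z]^n` of rank `k` and of
degree `δ`, the degree being the highest degree of the `k × k` minors of a generator matrix
(a generator matrix exists, and the value is the same for all of them). -/
structure IsConvolutionalCode (n k δ : ℕ) (C : Submodule F[X] (Fin n → F[X])) : Prop where
  rank_eq : Module.finrank F[X] C = k
  exists_generator : ∃ G : Matrix (Fin k) (Fin n) F[X], IsGeneratorMatrix G C
  degree_eq : ∀ G : Matrix (Fin k) (Fin n) F[X], IsGeneratorMatrix G C → maxMinorDegree G = δ

/-- `H(z)` is a parity-check matrix of `C`: a vector `c(z)` lies in `C` iff `H(z) c(z)ᵀ = 0`. -/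
def IsParityCheckMatrix {m n : ℕ} (H : Matrix (Fin m) (Fin n) F[X])
    (C : Submodule F[X] (Fin n → F[X])) : Prop :=
  ∀ c : Fin n → F[X], c ∈ C ↔ H.mulVec c = 0

/-- The `i`-th coefficient vector `v_i ∈ F^n` of `v(z) = ∑ v_i z^i`. -/
def coeffVec {n : ℕ} (v : Fin n → F[X]) (i : ℕ) : Fin n → F :=
  fun l => (v l).coeff i

/-- The weight of the truncation `v_0 + v_1 z + ⋯ + v_j z^j`. -/
def truncWeight [DecidableEq F] {n : ℕ} (j : ℕ) (v : Fin n → F[X]) : ℕ :=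
  ∑ i ∈ Finset.range (j + 1), hammingNorm (coeffVec v i)

/-- The `j`-th column distance: the minimal weight of `v_0 + ⋯ + v_j z^j` over the codewords
`v(z)` with `v_0 ≠ 0`. (The infimum of a nonempty set of naturals is its minimum; it is `0` if
there is no such codeword.) -/
noncomputable def columnDistance [DecidableEq F] {n : ℕ} (C : Submodule F[X] (Fin n → F[X]))
    (j : ℕ) : ℕ :=
  sInf {w | ∃ v ∈ C, coeffVec v 0 ≠ 0 ∧ truncWeight j v = w}

/-- The `(n, k, δ)` convolutional code `C` is maximum distance profile:
`d_j^c = (n-k)(j+1)+1` for all `j = 0, …, L`, with `L = ⌊δ/k⌋ + ⌊δ/(n-k)⌋`. -/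
structure IsMDP [DecidableEq F] (n k δ : ℕ) (C : Submodule F[X] (Fin n → F[X])) : Prop where
  isCode : IsConvolutionalCode n k δ C
  columnDistance_eq : ∀ j ≤ δ / k + δ / (n - k), columnDistance C j = (n - k) * (j + 1) + 1

end ConvCode

namespace ConvCode

open Polynomial Matrix

variable {F : Type*} [Field F] {m n k : ℕ}

/-! Write `m = n - k`, `ν = δ / m`, `d = ⌊δ / k⌋`, so `L = d + ν`. A column set of the sliding
matrix that is not trivially singular gives a uniquely solvable system; since the matrix is block
lower triangular, the same holds for its first `s ≤ L + 1` blocks.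

Since `(L + 1) m ≤ (d + 1) n`, the first `(L + 1) m` columns lie in the first `d + 1` blocks. Hence
some `c` of degree at most `d` gives `H c` any prescribed coefficients up to degree `d + ν`, which
are all its coefficients. So `H` has a polynomial right inverse, hence is left prime, and reading
off the top coefficient, `H_ν` is surjective.

The code is `ker H`. Uniqueness bounds the column distances from below, and a greedy codeword
attains the bound. The minors of a generator matrix have the degrees of the complementary minors of
`H`; these are at most `m ν = δ`, with equality where the minor of `H_ν` is nonzero. -/

/-! ### The sliding matrix as truncated polynomial multiplication -/

/-- The `(a, i)` entry of the product of the sliding parity-check matrix of `H` with the sequence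
`x`, where `x (b * n + l)` is the entry in column `l` of block column `b`. -/
def blockConv (H : Matrix (Fin m) (Fin n) F[X]) (x : ℕ → F) (a : ℕ) (i : Fin m) : F :=
  ∑ b ∈ Finset.range (a + 1), ∑ l : Fin n, (H i l).coeff (a - b) * x (b * n + l)

theorem blockConv_congr (H : Matrix (Fin m) (Fin n) F[X]) {x y : ℕ → F} {s a : ℕ} (ha : a < s)
    (h : ∀ p < s * n, x p = y p) (i : Fin m) : blockConv H x a i = blockConv H y a i := by
  refine Finset.sum_congr rfl fun b hb => Finset.sum_congr rfl fun l _ => ?_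
  rw [h]
  have hb : b + 1 ≤ s := by have := Finset.mem_range.1 hb; omega
  have := Nat.mul_le_mul_right n hb
  have := l.2
  rw [Nat.succ_mul] at *
  omega

theorem slidingParityCheck_mulVec (H : Matrix (Fin m) (Fin n) F[X]) (j : ℕ) (x : ℕ → F)
    (a : Fin (j + 1)) (i : Fin m) :
    (slidingParityCheck H j *ᵥ fun p => x p) (finProdFinEquiv (a, i)) = blockConv H x a i := by
  have key : ∀ (b : Fin (j + 1)) (l : Fin n),
      slidingParityCheck H j (finProdFinEquiv (a, i)) (finProdFinEquiv (b, l)) =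
        if (b : ℕ) ≤ a then (H i l).coeff (a - b) else 0 := by
    intro b l
    have h1 := finProdFinEquiv.symm_apply_apply (a, i)
    have h2 := finProdFinEquiv.symm_apply_apply (b, l)
    rw [finProdFinEquiv_symm_apply, Prod.mk.injEq] at h1 h2
    simp only [slidingParityCheck, Matrix.of_apply, h1.1, h1.2, h2.1, h2.2]
  rw [Matrix.mulVec, dotProduct, ← finProdFinEquiv.sum_comp, Fintype.sum_prod_type]
  simp only [key, ite_mul, zero_mul]
  rw [blockConv, ← Finset.sum_subset (s₁ := (Finset.range (j + 1)).filter (· ≤ (a : ℕ)))]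
  · rw [Finset.sum_filter, ← Fin.sum_univ_eq_sum_range (fun b => if b ≤ (a : ℕ) then
      ∑ l : Fin n, (H i l).coeff (a - b) * x (b * n + l) else 0)]
    refine Finset.sum_congr rfl fun b _ => ?_
    split_ifs
    · refine Finset.sum_congr rfl fun l _ => ?_
      congr 2
      simp [mul_comm, add_comm]
    · simp
  · intro b
    simp only [Finset.mem_filter, Finset.mem_range]
    omega
  · intro b h1 h2
    have := a.2
    simp only [Finset.mem_filter, Finset.mem_range] at h1 h2
    omega

theorem coeff_mulVec (H : Matrix (Fin m) (Fin n) F[X]) (c : Fin n → F[X]) (x : ℕ → F) (s : ℕ)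
    (hx : ∀ b < s, ∀ l : Fin n, x (b * n + l) = (c l).coeff b) {a : ℕ} (ha : a < s) (i : Fin m) :
    ((H *ᵥ c) i).coeff a = blockConv H x a i := by
  rw [Matrix.mulVec, dotProduct, finsetSum_coeff, blockConv, Finset.sum_comm]
  refine Finset.sum_congr rfl fun l _ => ?_
  rw [mul_comm, coeff_mul, Finset.Nat.sum_antidiagonal_eq_sum_range_succ
    (fun b e => (c l).coeff b * (H i l).coeff e)]
  refine Finset.sum_congr rfl fun b hb => ?_
  rw [hx b (by have := Finset.mem_range.1 hb; omega), mul_comm]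

/-! ### Admissible column sets and the systems they solve -/

/-- A set of columns among the first `N` blocks of `n` columns that selects a square submatrix
which is not trivially singular. -/
structure IsAdmissible (m n N : ℕ) (T : Finset ℕ) : Prop where
  subset : T ⊆ Finset.range (N * n)
  card_eq : T.card = N * m
  le_card : ∀ s ≤ N, s * m ≤ (T.filter (· < s * n)).card

/-- Adjoining the first `m` columns of each further block keeps the count exact, so the hypothesis
at `L` also controls shorter truncations. -/
theorem IsAdmissible.exists_extension {s N : ℕ} {T : Finset ℕ} (hT : IsAdmissible m n s T)
    (hmn : m ≤ n) (hN : s ≤ N) :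
    ∃ T', IsAdmissible m n N T' ∧ T'.filter (· < s * n) = T := by
  induction N, hN using Nat.le_induction with
  | base =>
    exact ⟨T, hT, Finset.filter_true_of_mem fun p hp => Finset.mem_range.1 (hT.subset hp)⟩
  | succ N hN ih =>
    obtain ⟨T', hT', h⟩ := ih
    have hdisj : Disjoint T' (Finset.Ico (N * n) (N * n + m)) := by
      rw [Finset.disjoint_left]
      intro p hp hp'
      have := Finset.mem_range.1 (hT'.subset hp)
      have := Finset.mem_Ico.1 hp'
      omega
    have hcard : (T' ∪ Finset.Ico (N * n) (N * n + m)).card = (N + 1) * m := by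
      rw [Finset.card_union_of_disjoint hdisj, hT'.card_eq, Nat.card_Ico, Nat.succ_mul]
      omega
    have hsub : T' ∪ Finset.Ico (N * n) (N * n + m) ⊆ Finset.range ((N + 1) * n) := by
      intro p hp
      rw [Finset.mem_range, Nat.succ_mul]
      rcases Finset.mem_union.1 hp with hp | hp
      · have := Finset.mem_range.1 (hT'.subset hp)
        omega
      · have := Finset.mem_Ico.1 hp
        omega
    refine ⟨T' ∪ Finset.Ico (N * n) (N * n + m), ⟨hsub, hcard, fun r hr => ?_⟩, ?_⟩
    · rcases hr.lt_or_eq with hr | rfl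
      · exact (hT'.le_card r (by omega)).trans (Finset.card_le_card
          (Finset.filter_subset_filter _ Finset.subset_union_left))
      · rw [Finset.filter_true_of_mem fun p hp => Finset.mem_range.1 (hsub hp), hcard]
    · rw [Finset.filter_union, h, Finset.filter_false_of_mem, Finset.union_empty]
      intro p hp
      have := Finset.mem_Ico.1 hp
      have := Nat.mul_le_mul_right n hN
      omega

theorem isAdmissible_range {N : ℕ} (hmn : m ≤ n) : IsAdmissible m n N (Finset.range (N * m)) where
  subset := Finset.range_subset_range.2 (Nat.mul_le_mul_left N hmn)
  card_eq := Finset.card_range _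
  le_card s hs := by
    rw [← Finset.card_range (s * m)]
    refine Finset.card_le_card fun p hp => ?_
    have := Finset.mem_range.1 hp
    have := Nat.mul_le_mul_left s hmn
    have := Nat.mul_le_mul_right m hs
    simp only [Finset.mem_filter, Finset.mem_range]
    omega

theorem MinorCriterion.exists_blockConv_eq {H : Matrix (Fin m) (Fin n) F[X]} {L : ℕ}
    (hH : MinorCriterion H L) {T : Finset ℕ} (hT : IsAdmissible m n (L + 1) T)
    (y : ℕ → Fin m → F) :
    ∃ x : ℕ → F, (∀ p ∉ T, x p = 0) ∧ ∀ a < L + 1, ∀ i, blockConv H x a i = y a i := by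
  classical
  let t := T.orderEmbOfFin hT.card_eq
  have ht : ∀ r, t r ∈ T := fun r => T.orderEmbOfFin_mem hT.card_eq r
  let t' : Fin ((L + 1) * m) ↪o Fin ((L + 1) * n) := OrderEmbedding.ofStrictMono
    (fun r => ⟨t r, Finset.mem_range.1 (hT.subset (ht r))⟩) fun r r' h => t.strictMono h
  have hdet : ((slidingParityCheck H L).submatrix id t').det ≠ 0 := by
    refine hH t' fun s _ hs r hr => ?_
    by_contra hlt
    have hlt : s * n ≤ t r := by
      change ¬ (t r + 1 ≤ s * n) at hlt
      omega
    -- If the column numbered `s m` lay beyond the first `s` blocks, those blocks would hold at most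
    -- `r = s m - 1` selected columns, against `le_card`.
    have hsub : T.filter (· < s * n) ⊆ (Finset.Iio r).image t := by
      intro p hp
      obtain ⟨hpT, hp⟩ := Finset.mem_filter.1 hp
      have : p ∈ Set.range t := by
        rw [Finset.range_orderEmbOfFin]; exact hpT
      obtain ⟨q, rfl⟩ := this
      exact Finset.mem_image_of_mem _ (Finset.mem_Iio.2 (t.lt_iff_lt.1 (by omega)))
    have h1 := (hT.le_card s (by omega)).trans ((Finset.card_le_card hsub).trans
      Finset.card_image_le)
    rw [Fin.card_Iio] at h1
    omega
  let A := (slidingParityCheck H L).submatrix id t'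
  let w : Fin ((L + 1) * m) → F :=
    fun r => y (finProdFinEquiv.symm r).1 (finProdFinEquiv.symm r).2
  let z := A⁻¹ *ᵥ w
  have hz : A *ᵥ z = w := by
    rw [Matrix.mulVec_mulVec, Matrix.mul_nonsing_inv _ (isUnit_iff_ne_zero.2 hdet),
      Matrix.one_mulVec]
  let x : ℕ → F := fun p => ∑ r, if t r = p then z r else 0
  refine ⟨x, fun p hp => Finset.sum_eq_zero fun r _ => if_neg ?_, fun a ha i => ?_⟩
  · rintro rfl
    exact hp (ht r)
  · rw [← slidingParityCheck_mulVec H L x ⟨a, ha⟩ i]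
    have : w (finProdFinEquiv (⟨a, ha⟩, i)) = y a i := by
      simp only [w, Equiv.symm_apply_apply]
    rw [← this, ← hz]
    simp only [Matrix.mulVec, dotProduct, x, Finset.mul_sum]
    rw [Finset.sum_comm]
    refine Finset.sum_congr rfl fun r _ => ?_
    rw [Finset.sum_eq_single (t' r)]
    · exact congrArg _ (if_pos rfl)
    · intro p _ hp
      rw [if_neg, mul_zero]
      intro h
      exact hp (Fin.ext h.symm)
    · simp

/-- The first `s` block rows ignore later block columns, so a solution for an extended column set
may be cut off at `s n`. -/
theorem MinorCriterion.exists_blockConv_eq_of_le {H : Matrix (Fin m) (Fin n) F[X]} {L s : ℕ}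
    (hH : MinorCriterion H L) (hmn : m ≤ n) (hs : s ≤ L + 1) {T : Finset ℕ}
    (hT : IsAdmissible m n s T) (y : ℕ → Fin m → F) :
    ∃ x : ℕ → F, (∀ p ∉ T, x p = 0) ∧ ∀ a < s, ∀ i, blockConv H x a i = y a i := by
  obtain ⟨T', hT', h⟩ := hT.exists_extension hmn hs
  obtain ⟨x, hx, hxy⟩ := hH.exists_blockConv_eq hT' y
  refine ⟨fun p => if p < s * n then x p else 0, fun p hp => ?_, fun a ha i => ?_⟩
  · dsimp only
    split_ifs with hlt
    · refine hx p fun hp' => hp ?_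
      rw [← h]
      exact Finset.mem_filter.2 ⟨hp', hlt⟩
    · rfl
  · rw [← hxy a (by omega) i]
    exact blockConv_congr H ha (fun p hp => if_pos hp) i

/-- The system on `T` is square, with `s m` unknowns and equations, so solvability for every
right-hand side forces uniqueness. -/
theorem MinorCriterion.eq_zero_of_blockConv_eq_zero {H : Matrix (Fin m) (Fin n) F[X]} {L s : ℕ}
    (hH : MinorCriterion H L) (hmn : m ≤ n) (hs : s ≤ L + 1) {T : Finset ℕ}
    (hT : IsAdmissible m n s T) {x : ℕ → F} (hx : ∀ p ∉ T, x p = 0)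
    (hx0 : ∀ a < s, ∀ i, blockConv H x a i = 0) : x = 0 := by
  classical
  let ext : (T → F) →ₗ[F] (ℕ → F) :=
    { toFun := fun f p => if h : p ∈ T then f ⟨p, h⟩ else 0
      map_add' := fun f g => by ext p; by_cases h : p ∈ T <;> simp [h]
      map_smul' := fun r f => by ext p; by_cases h : p ∈ T <;> simp [h] }
  have hext : ∀ x : ℕ → F, (∀ p ∉ T, x p = 0) → ext (fun p => x p) = x := by
    intro x hx
    ext p
    by_cases h : p ∈ T
    · simp [ext, h]
    · simp [ext, h, hx p h]
  let conv : (ℕ → F) →ₗ[F] (Fin s × Fin m → F) :=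
    { toFun := fun x r => blockConv H x r.1 r.2
      map_add' := fun x y => by
        ext r; simp [blockConv, mul_add, Finset.sum_add_distrib]
      map_smul' := fun r x => by
        ext; simp [blockConv, Finset.mul_sum, mul_left_comm] }
  have hsurj : Function.Surjective (conv ∘ₗ ext) := by
    intro y
    obtain ⟨z, hz, hzy⟩ := hH.exists_blockConv_eq_of_le hmn hs hT
      (fun a i => if h : a < s then y (⟨a, h⟩, i) else 0)
    refine ⟨fun p => z p, ?_⟩
    rw [LinearMap.comp_apply, hext z hz]
    ext ⟨a, i⟩
    simpa [conv] using hzy a a.2 i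
  have hinj : Function.Injective (conv ∘ₗ ext) :=
    (LinearMap.injective_iff_surjective_of_finrank_eq_finrank
      (by simp [hT.card_eq])).2 hsurj
  have h0 : (conv ∘ₗ ext) (fun p => x p) = 0 := by
    rw [LinearMap.comp_apply, hext x hx]
    ext ⟨a, i⟩
    exact hx0 a a.2 i
  rw [← hext x hx, hinj (h0.trans (map_zero _).symm), map_zero]

/-! ### Right inverse, leading coefficient matrix and left primeness -/

/-- By `hle` the leading `(d + ν + 1) m` columns fit into `d + 1` blocks, so the solution supported
there is a polynomial vector of degree at most `d`. -/
theorem MinorCriterion.exists_mulVec_coeff_eq {H : Matrix (Fin m) (Fin n) F[X]} {d ν : ℕ}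
    (hH : MinorCriterion H (d + ν)) (hmn : m ≤ n) (hle : (d + ν + 1) * m ≤ (d + 1) * n)
    (y : ℕ → Fin m → F) :
    ∃ c : Fin n → F[X], (∀ l, (c l).natDegree ≤ d) ∧
      ∀ a ≤ d + ν, ∀ i, ((H *ᵥ c) i).coeff a = y a i := by
  obtain ⟨x, hx, hxy⟩ := hH.exists_blockConv_eq (isAdmissible_range hmn) y
  refine ⟨fun l => ∑ b ∈ Finset.range (d + 1), monomial b (x (b * n + l)), fun l => ?_,
    fun a ha i => ?_⟩
  · refine natDegree_sum_le_of_forall_le _ _ fun b hb => (natDegree_monomial_le _).trans ?_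
    have := Finset.mem_range.1 hb
    omega
  · rw [← hxy a (by omega) i]
    refine coeff_mulVec H _ x (a + 1) (fun b _ l => ?_) (Nat.lt_succ_self a) i
    simp only [finsetSum_coeff, coeff_monomial, Finset.sum_ite_eq', Finset.mem_range]
    split_ifs with hb
    · rfl
    · refine hx _ fun hp => ?_
      have := Finset.mem_range.1 hp
      have := Nat.mul_le_mul_right n (not_lt.1 hb)
      omega

theorem MinorCriterion.exists_right_inverse {H : Matrix (Fin m) (Fin n) F[X]} {d ν : ℕ}
    (hH : MinorCriterion H (d + ν)) (hmn : m ≤ n) (hle : (d + ν + 1) * m ≤ (d + 1) * n)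
    (hdeg : ∀ i l, (H i l).natDegree ≤ ν) :
    ∃ R : Matrix (Fin n) (Fin m) F[X], H * R = 1 := by
  have key : ∀ r : Fin m, ∃ c : Fin n → F[X],
      ∀ i, (H *ᵥ c) i = C ((1 : Matrix (Fin m) (Fin m) F) i r) := by
    intro r
    obtain ⟨c, hc, hcy⟩ := hH.exists_mulVec_coeff_eq hmn hle
      (fun a i => if a = 0 then (1 : Matrix (Fin m) (Fin m) F) i r else 0)
    refine ⟨c, fun i => Polynomial.ext fun a => ?_⟩
    rw [coeff_C]
    by_cases ha : a ≤ d + ν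
    · exact hcy a ha i
    -- Beyond `d + ν` nothing was prescribed, but `H c` has degree at most `d + ν`.
    · rw [if_neg (by omega)]
      refine coeff_eq_zero_of_natDegree_lt (lt_of_le_of_lt ?_ (not_le.1 ha))
      rw [Matrix.mulVec, dotProduct]
      refine natDegree_sum_le_of_forall_le _ _ fun l _ => ?_
      have := natDegree_mul_le (p := H i l) (q := c l)
      have := hdeg i l
      have := hc l
      omega
  choose c hc using key
  refine ⟨Matrix.of fun l r => c r l, ?_⟩
  refine Matrix.ext fun i r => ?_
  have h : (H * Matrix.of fun l r => c r l) i r = (H *ᵥ c r) i := by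
    simp only [Matrix.mul_apply, Matrix.mulVec, dotProduct, Matrix.of_apply]
  rw [h, hc]
  rw [Matrix.one_apply, Matrix.one_apply]
  split_ifs <;> simp

/-- In degree `d + ν` only the product of `H_ν` with the degree `d` coefficient of `c` survives. -/
theorem MinorCriterion.exists_coeff_mulVec_eq {H : Matrix (Fin m) (Fin n) F[X]} {d ν : ℕ}
    (hH : MinorCriterion H (d + ν)) (hmn : m ≤ n) (hle : (d + ν + 1) * m ≤ (d + 1) * n)
    (hdeg : ∀ i l, (H i l).natDegree ≤ ν) (u : Fin m → F) :
    ∃ w : Fin n → F, H.map (coeff · ν) *ᵥ w = u := by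
  obtain ⟨c, hc, hcy⟩ := hH.exists_mulVec_coeff_eq hmn hle (fun _ => u)
  refine ⟨fun l => (c l).coeff d, funext fun i => ?_⟩
  rw [← hcy (d + ν) le_rfl i]
  simp only [Matrix.mulVec, dotProduct, finsetSum_coeff, Matrix.map_apply]
  refine Finset.sum_congr rfl fun l _ => ?_
  rw [add_comm d ν, coeff_mul_add_eq_of_natDegree_le (hdeg i l) (hc l)]

theorem isLeftPrime_of_right_inverse {H : Matrix (Fin m) (Fin n) F[X]}
    {R : Matrix (Fin n) (Fin m) F[X]} (hR : H * R = 1) : IsLeftPrime H := by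
  rintro M H' rfl
  exact (Matrix.isUnit_iff_isUnit_det _).2
    (Matrix.isUnit_det_of_right_inverse (B := H' * R) (by rw [← Matrix.mul_assoc, hR]))

/-! ### Lower bound on the column distances -/

theorem sum_hammingNorm_coeffVec [DecidableEq F] (v : Fin n → F[X]) (x : ℕ → F)
    (hx : ∀ (b : ℕ) (l : Fin n), x (b * n + l) = (v l).coeff b) (s : ℕ) :
    ((Finset.range (s * n)).filter (x · ≠ 0)).card =
      ∑ i ∈ Finset.range s, hammingNorm (coeffVec v i) := by
  induction s with
  | zero => simp
  | succ s ih =>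
    rw [Finset.sum_range_succ, ← ih, Finset.card_filter, Finset.card_filter, Nat.succ_mul,
      Finset.sum_range_add, ← Fin.sum_univ_eq_sum_range (fun l => if x (s * n + l) ≠ 0 then 1 else 0)]
    simp only [hx, hammingNorm, Finset.card_filter]
    rfl

/-- If the bound failed, take the least `s ≥ 1` whose first `s` blocks carry weight at most `s m`.
Minimality makes the support there admissible once padded to size `s m`, so uniqueness kills the
truncation, contradicting `v_0 ≠ 0`. -/
theorem MinorCriterion.lt_truncWeight [DecidableEq F] {H : Matrix (Fin m) (Fin n) F[X]} {L j : ℕ}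
    (hH : MinorCriterion H L) (hmn : m ≤ n) (hj : j ≤ L) {v : Fin n → F[X]} (hv : H *ᵥ v = 0)
    (hv0 : coeffVec v 0 ≠ 0) : m * (j + 1) < truncWeight j v := by
  obtain ⟨l₀, hl₀⟩ := Function.ne_iff.1 hv0
  have hn : 0 < n := l₀.pos
  let x : ℕ → F := fun p => (v ⟨p % n, Nat.mod_lt p hn⟩).coeff (p / n)
  have hx : ∀ (b : ℕ) (l : Fin n), x (b * n + l) = (v l).coeff b := by
    intro b l
    have h1 : (b * n + l) % n = l := by
      rw [Nat.mul_add_mod_self_right, Nat.mod_eq_of_lt l.2]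
    have h2 : (b * n + l) / n = b := by
      rw [mul_comm, Nat.mul_add_div hn, Nat.div_eq_of_lt l.2, add_zero]
    simp only [x, h1, h2]
  let S : ℕ → Finset ℕ := fun s => (Finset.range (s * n)).filter (x · ≠ 0)
  by_contra hlt
  have hex : ∃ s, 1 ≤ s ∧ (S s).card ≤ s * m := by
    refine ⟨j + 1, by omega, ?_⟩
    rw [sum_hammingNorm_coeffVec v x hx, mul_comm]
    exact not_lt.1 hlt
  obtain ⟨s, ⟨hs1, hsm⟩, hmin⟩ : ∃ s, (1 ≤ s ∧ (S s).card ≤ s * m) ∧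
      ∀ r < s, ¬ (1 ≤ r ∧ (S r).card ≤ r * m) := by
    classical exact ⟨Nat.find hex, Nat.find_spec hex, fun r hr => Nat.find_min hex hr⟩
  have hsj : s ≤ j + 1 := by
    by_contra hsj
    refine hmin (j + 1) (by omega) ⟨by omega, ?_⟩
    rw [sum_hammingNorm_coeffVec v x hx, mul_comm]
    exact not_lt.1 hlt
  obtain ⟨T, hST, hT, hcard⟩ := Finset.exists_subsuperset_card_eq
    (Finset.filter_subset (x · ≠ 0) (Finset.range (s * n))) hsm
    (by rw [Finset.card_range]; exact Nat.mul_le_mul_left s hmn)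
  have hadm : IsAdmissible m n s T := by
    refine ⟨hT, hcard, fun r hr => ?_⟩
    rcases hr.lt_or_eq with hr | rfl
    · rcases Nat.eq_zero_or_pos r with rfl | hr0
      · simp
      · have h1 : r * m < (S r).card := by
          have := hmin r hr
          omega
        refine h1.le.trans (Finset.card_le_card fun p hp => ?_)
        obtain ⟨hp, hp0⟩ := Finset.mem_filter.1 hp
        have hp := Finset.mem_range.1 hp
        refine Finset.mem_filter.2 ⟨hST (Finset.mem_filter.2 ⟨Finset.mem_range.2 ?_, hp0⟩), hp⟩
        exact hp.trans_le (Nat.mul_le_mul_right n hr.le)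
    · rw [Finset.filter_true_of_mem fun p hp => Finset.mem_range.1 (hT hp), hcard]
  let x' : ℕ → F := fun p => if p < s * n then x p else 0
  have hx' : x' = 0 := by
    refine hH.eq_zero_of_blockConv_eq_zero hmn (by omega) hadm (fun p hp => ?_) fun a ha i => ?_
    · by_contra h
      have hps : p < s * n := by
        by_contra hps
        exact h (if_neg hps)
      have hxp : x p ≠ 0 := by
        simpa only [x', if_pos hps] using h
      exact hp (hST (Finset.mem_filter.2 ⟨Finset.mem_range.2 hps, hxp⟩))
    · rw [blockConv_congr H ha (y := x) (fun p hp => if_pos hp),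
        ← coeff_mulVec H v x s (fun b _ l => hx b l) ha, hv]
      simp
  have hlt : (l₀ : ℕ) < s * n := l₀.2.trans_le (Nat.le_mul_of_pos_left n hs1)
  have h0 := congrFun hx' l₀
  simp only [x', if_pos hlt, Pi.zero_apply] at h0
  have h1 := hx 0 l₀
  rw [zero_mul, zero_add, h0] at h1
  exact hl₀ h1.symm

/-! ### Codewords attaining the bound -/

theorem coeffVec_mulVec_zero (H : Matrix (Fin m) (Fin n) F[X]) (c : Fin n → F[X]) :
    coeffVec (H *ᵥ c) 0 = H.map (coeff · 0) *ᵥ coeffVec c 0 := by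
  ext i
  simp [coeffVec, Matrix.mulVec, dotProduct, finsetSum_coeff, mul_coeff_zero]

/-- `H u` is divisible by `z`, say `H u = z e`; subtracting `z R e` corrects it without touching the
constant term. -/
theorem exists_mulVec_eq_zero_of_right_inverse {H : Matrix (Fin m) (Fin n) F[X]}
    {R : Matrix (Fin n) (Fin m) F[X]} (hR : H * R = 1) {u : Fin n → F}
    (hu : H.map (coeff · 0) *ᵥ u = 0) :
    ∃ g : Fin n → F[X], H *ᵥ g = 0 ∧ coeffVec g 0 = u := by
  have hCu : coeffVec (fun l => C (u l)) 0 = u := by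
    ext l; simp [coeffVec]
  have hdvd : ∀ i, (X : F[X]) ∣ (H *ᵥ fun l => C (u l)) i := by
    intro i
    have h := coeffVec_mulVec_zero H fun l => C (u l)
    rw [hCu, hu] at h
    exact X_dvd_iff.2 (congrFun h i)
  choose e he using hdvd
  refine ⟨(fun l => C (u l)) - (X : F[X]) • (R *ᵥ e), ?_, ?_⟩
  · rw [Matrix.mulVec_sub, Matrix.mulVec_smul, Matrix.mulVec_mulVec, hR, Matrix.one_mulVec,
      sub_eq_zero]
    exact funext he
  · rw [← hCu]
    ext l
    simp [coeffVec]

theorem hammingNorm_le_card [DecidableEq F] {w : Fin n → F} {s : Finset (Fin n)}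
    (h : ∀ l ∉ s, w l = 0) : hammingNorm w ≤ s.card := by
  refine Finset.card_le_card fun l hl => ?_
  by_contra hls
  exact (Finset.mem_filter.1 hl).2 (h l hls)

/-- One column outside `s` plus a correction supported on `s` starts a codeword of initial weight at
most `m + 1`. Each later coefficient can be replaced by one supported on `s`, costing at most `m`.
-/
theorem exists_truncWeight_le [DecidableEq F] {H : Matrix (Fin m) (Fin n) F[X]}
    {R : Matrix (Fin n) (Fin m) F[X]} (hR : H * R = 1) (hmn : m < n) {s : Finset (Fin n)}
    (hs : s.card = m)
    (hsol : ∀ y : Fin m → F, ∃ w : Fin n → F, (∀ l ∉ s, w l = 0) ∧ H.map (coeff · 0) *ᵥ w = y)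
    (j : ℕ) :
    ∃ v : Fin n → F[X], H *ᵥ v = 0 ∧ coeffVec v 0 ≠ 0 ∧ truncWeight j v ≤ m * (j + 1) + 1 := by
  induction j with
  | zero =>
    obtain ⟨l₀, hl₀⟩ : ∃ l₀, l₀ ∉ s := by
      by_contra! h
      rw [Finset.eq_univ_of_forall h, Finset.card_univ, Fintype.card_fin] at hs
      omega
    obtain ⟨w, hws, hw⟩ := hsol (H.map (coeff · 0) *ᵥ Pi.single l₀ 1)
    obtain ⟨g, hg, hg0⟩ := exists_mulVec_eq_zero_of_right_inverse hR
      (u := Pi.single l₀ 1 - w) (by rw [Matrix.mulVec_sub, hw, sub_self])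
    refine ⟨g, hg, ?_, ?_⟩
    · rw [hg0]
      intro h
      have := congrFun h l₀
      simp [hws l₀ hl₀] at this
    · rw [truncWeight, zero_add, Finset.sum_range_one, hg0, mul_one, ← hs,
        ← Finset.card_insert_of_notMem hl₀]
      refine hammingNorm_le_card fun l hl => ?_
      rw [Finset.mem_insert, not_or] at hl
      simp [hl.1, hws l hl.2]
  | succ j ih =>
    obtain ⟨v, hv, hv0, hle⟩ := ih
    obtain ⟨w, hws, hw⟩ := hsol (H.map (coeff · 0) *ᵥ coeffVec v (j + 1))
    -- Adding `z ^ (j + 1) g` turns the coefficient `v_{j+1}` into `w` and leaves the earlier ones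
    -- alone.
    obtain ⟨g, hg, hg0⟩ := exists_mulVec_eq_zero_of_right_inverse hR
      (u := w - coeffVec v (j + 1)) (by rw [Matrix.mulVec_sub, hw, sub_self])
    have hlow : ∀ i < j + 1, coeffVec (v + (X : F[X]) ^ (j + 1) • g) i = coeffVec v i := by
      intro i hi
      ext l
      rw [coeffVec, Pi.add_apply, Pi.smul_apply, coeff_add, smul_eq_mul, coeff_X_pow_mul',
        if_neg (not_le.2 hi), add_zero, coeffVec]
    have htop : coeffVec (v + (X : F[X]) ^ (j + 1) • g) (j + 1) = w := by
      ext l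
      have := congrFun hg0 l
      simp only [coeffVec, Pi.sub_apply] at this
      simp [coeffVec, coeff_X_pow_mul', this]
    refine ⟨v + (X : F[X]) ^ (j + 1) • g, ?_, ?_, ?_⟩
    · rw [Matrix.mulVec_add, Matrix.mulVec_smul, hv, hg, smul_zero, add_zero]
    · rwa [hlow 0 (by omega)]
    · rw [truncWeight, Finset.sum_range_succ, htop,
        Finset.sum_congr rfl fun i hi => by rw [hlow i (Finset.mem_range.1 hi)]]
      have h1 : hammingNorm w ≤ m := hs ▸ hammingNorm_le_card hws
      have h2 : m * (j + 1 + 1) = m * (j + 1) + m := by ring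
      rw [truncWeight] at hle
      omega

theorem MinorCriterion.exists_support_solution {H : Matrix (Fin m) (Fin n) F[X]} {L : ℕ}
    (hH : MinorCriterion H L) (hmn : m ≤ n) :
    ∃ s : Finset (Fin n), s.card = m ∧ ∀ y : Fin m → F, ∃ w : Fin n → F,
      (∀ l ∉ s, w l = 0) ∧ H.map (coeff · 0) *ᵥ w = y := by
  refine ⟨Finset.univ.map (Fin.castLEEmb hmn), by simp, fun y => ?_⟩
  obtain ⟨x, hx, hxy⟩ := hH.exists_blockConv_eq_of_le hmn (s := 1) (by omega)
    (isAdmissible_range hmn) (fun _ => y)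
  refine ⟨fun l => x l, fun l hl => hx l fun h => hl ?_, funext fun i => ?_⟩
  · rw [one_mul, Finset.mem_range] at h
    exact Finset.mem_map.2 ⟨⟨l, h⟩, Finset.mem_univ _, rfl⟩
  · rw [← hxy 0 one_pos i]
    simp [blockConv, Matrix.mulVec, dotProduct]

theorem MinorCriterion.columnDistance_eq [DecidableEq F] {H : Matrix (Fin m) (Fin n) F[X]}
    {L j : ℕ} (hH : MinorCriterion H L) (hmn : m < n) (hj : j ≤ L)
    {R : Matrix (Fin n) (Fin m) F[X]} (hR : H * R = 1) {C : Submodule F[X] (Fin n → F[X])}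
    (hC : IsParityCheckMatrix H C) : columnDistance C j = m * (j + 1) + 1 := by
  obtain ⟨s, hs, hsol⟩ := hH.exists_support_solution hmn.le
  obtain ⟨v, hv, hv0, hle⟩ := exists_truncWeight_le hR hmn hs hsol j
  have hmem : truncWeight j v ∈ {w | ∃ v ∈ C, coeffVec v 0 ≠ 0 ∧ truncWeight j v = w} :=
    ⟨v, (hC v).2 hv, hv0, rfl⟩
  refine le_antisymm ((Nat.sInf_le hmem).trans hle) (le_csInf ⟨_, hmem⟩ ?_)
  rintro _ ⟨v', hv', hv'0, rfl⟩
  exact hH.lt_truncWeight hmn.le hj ((hC v').1 hv') hv'0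

/-! ### Degree of the code through complementary minors -/

theorem exists_det_submatrix_ne_zero (A : Matrix (Fin m) (Fin n) F)
    (hA : ∀ u : Fin m → F, ∃ w, A *ᵥ w = u) :
    ∃ f : Fin m → Fin n, Function.Injective f ∧ (A.submatrix id f).det ≠ 0 := by
  obtain ⟨κ, a, ha, hspan, hli⟩ := exists_linearIndependent' F (fun l => Aᵀ l)
  have htop : ⊤ ≤ Submodule.span F (Set.range ((fun l => Aᵀ l) ∘ a)) := by
    rw [hspan]
    intro u _
    obtain ⟨w, rfl⟩ := hA u
    rw [Matrix.mulVec_eq_sum]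
    refine Submodule.sum_mem _ fun l _ => ?_
    rw [op_smul_eq_smul]
    exact Submodule.smul_mem _ _ (Submodule.subset_span (Set.mem_range_self l))
  let b := Module.Basis.mk hli htop
  have : Fintype κ := Fintype.ofInjective a ha
  let e : Fin m ≃ κ := (Pi.basisFun F (Fin m)).indexEquiv b
  refine ⟨a ∘ e, ha.comp e.injective, ?_⟩
  have h : LinearIndependent F (A.submatrix id (a ∘ e)).col := hli.comp e e.injective
  rw [Matrix.linearIndependent_cols_iff_isUnit, Matrix.isUnit_iff_isUnit_det] at h
  exact h.ne_zero

theorem coeff_det_of_natDegree_le (A : Matrix (Fin m) (Fin m) F[X]) {ν : ℕ}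
    (h : ∀ i j, (A i j).natDegree ≤ ν) : A.det.coeff (m * ν) = (A.map (coeff · ν)).det := by
  rw [Matrix.det_apply, Matrix.det_apply, finsetSum_coeff]
  refine Finset.sum_congr rfl fun σ _ => ?_
  have := coeff_prod_of_natDegree_le (s := Finset.univ) (fun i => A (σ i) i) ν fun i _ => h _ _
  rw [Finset.card_univ, Fintype.card_fin] at this
  rcases Int.units_eq_one_or (Equiv.Perm.sign σ) with hs | hs <;> simp [hs, this]

theorem natDegree_det_le (A : Matrix (Fin m) (Fin m) F[X]) {ν : ℕ}
    (h : ∀ i j, (A i j).natDegree ≤ ν) : A.det.natDegree ≤ m * ν := by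
  rw [Matrix.det_apply]
  refine natDegree_sum_le_of_forall_le _ _ fun σ _ => ?_
  have h1 : (∏ i, A (σ i) i).natDegree ≤ m * ν :=
    (natDegree_prod_le _ _).trans ((Finset.sum_le_card_nsmul _ _ ν fun i _ => h _ _).trans
      (by simp))
  rcases Int.units_eq_one_or (Equiv.Perm.sign σ) with hs | hs <;> simpa [hs] using h1

/-- Complementary full-size minors of a parity-check matrix with a right inverse and of a generator
matrix have the same degree. -/
theorem natDegree_det_generator {H : Matrix (Fin m) (Fin n) F[X]}
    {R : Matrix (Fin n) (Fin m) F[X]} (hR : H * R = 1) {C : Submodule F[X] (Fin n → F[X])}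
    (hC : IsParityCheckMatrix H C) {G : Matrix (Fin k) (Fin n) F[X]} (hG : IsGeneratorMatrix G C)
    (f : Fin m → Fin n) (t : Fin k → Fin n) (hft : Function.Bijective (Sum.elim f t)) :
    (G.submatrix id t).det.natDegree = (H.submatrix id f).det.natDegree := by
  let e : Fin m ⊕ Fin k ≃ Fin n := Equiv.ofBijective _ hft
  -- With `V` having rows `H` and the unit vectors `e_t`, and `U = [R | Gᵀ]`, the product `V U` is
  -- block lower triangular with diagonal blocks `1` and the transposed minor of `G`. Also `det V`
  -- is the minor of `H` on `f`, and `U` is unimodular.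
  let U : Matrix (Fin n) (Fin m ⊕ Fin k) F[X] := fromCols R Gᵀ
  let V : Matrix (Fin m ⊕ Fin k) (Fin n) F[X] := fromRows H ((1 : Matrix _ _ F[X]).submatrix t id)
  have hGmem : ∀ i, H *ᵥ G i = 0 := fun i =>
    (hC _).1 (hG.2 ▸ Submodule.subset_span ⟨i, rfl⟩)
  have hHG : H * Gᵀ = 0 := by
    refine Matrix.ext fun i j => ?_
    exact congrFun (hGmem j) i
  have hUsurj : ∀ c : Fin n → F[X], ∃ w, U *ᵥ w = c := by
    intro c
    -- Every `c` is `R (H c)` plus a codeword, so the columns of `U` span.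
    have hmem : c - R *ᵥ (H *ᵥ c) ∈ Submodule.span F[X] (Set.range fun i => G i) := by
      rw [hG.2, hC, Matrix.mulVec_sub, Matrix.mulVec_mulVec, hR, Matrix.one_mulVec, sub_self]
    obtain ⟨b, hb⟩ := (Submodule.mem_span_range_iff_exists_fun _).1 hmem
    refine ⟨Sum.elim (H *ᵥ c) b, ?_⟩
    rw [fromCols_mulVec_sumElim, Matrix.mulVec_eq_sum b]
    simp only [Matrix.transpose_transpose, op_smul_eq_smul]
    rw [hb, add_sub_cancel]
  have hUunit : IsUnit (U.submatrix e id).det := by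
    choose w hw using fun l => hUsurj (Pi.single l 1)
    refine Matrix.isUnit_det_of_right_inverse (B := Matrix.of fun r q => w (e q) r) ?_
    refine Matrix.ext fun p q => ?_
    have : (U.submatrix e id * Matrix.of fun r q => w (e q) r) p q = (U *ᵥ w (e q)) (e p) := by
      simp only [Matrix.mul_apply, Matrix.mulVec, dotProduct, Matrix.of_apply,
        Matrix.submatrix_apply, id]
    rw [this, hw, Pi.single_apply, Matrix.one_apply]
    simp only [e.injective.eq_iff]
  have hVdet : (V.submatrix id e).det = (H.submatrix id f).det := by
    have : V.submatrix id e = fromBlocks (H.submatrix id f) (H.submatrix id t) 0 1 := by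
      refine Matrix.ext ?_
      rintro (i | i) (j | j)
      · rfl
      · rfl
      · have hne : t i ≠ f j := fun h => by
          have := hft.1 (a₁ := Sum.inr i) (a₂ := Sum.inl j) h
          simp at this
        exact Matrix.one_apply_ne hne
      · change (1 : Matrix (Fin n) (Fin n) F[X]) (t i) (t j) = (1 : Matrix (Fin k) (Fin k) F[X]) i j
        have hinj : t i = t j ↔ i = j :=
          ⟨fun h => Sum.inr_injective (hft.1 (a₁ := Sum.inr i) (a₂ := Sum.inr j) h),
            fun h => h ▸ rfl⟩
        simp only [Matrix.one_apply, hinj]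
    rw [this, Matrix.det_fromBlocks_zero₂₁, Matrix.det_one, mul_one]
  have hVU : (V.submatrix id e * U.submatrix e id).det = (G.submatrix id t).det := by
    rw [Matrix.submatrix_mul_equiv, Matrix.submatrix_id_id, fromRows_mul_fromCols, hR, hHG,
      Matrix.det_fromBlocks_zero₁₂, Matrix.det_one, one_mul, ← Matrix.det_transpose]
    congr 1
    refine Matrix.ext fun i j => ?_
    simp [Matrix.mul_apply, Matrix.one_apply]
  rw [← hVU, Matrix.det_mul, hVdet]
  by_cases h0 : (H.submatrix id f).det = 0
  · rw [h0, zero_mul]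
  · rw [natDegree_mul h0 hUunit.ne_zero, natDegree_eq_zero_of_isUnit hUunit, add_zero]

theorem exists_complement (hn : n = m + k) {f : Fin m → Fin n} (hf : Function.Injective f) :
    ∃ t : Fin k ↪o Fin n, Function.Bijective (Sum.elim f t) := by
  have hcard : (Finset.univ.image f)ᶜ.card = k := by
    rw [Finset.card_compl, Finset.card_image_of_injective _ hf]
    simp
    omega
  refine ⟨(Finset.univ.image f)ᶜ.orderEmbOfFin hcard, ?_⟩
  rw [Fintype.bijective_iff_injective_and_card]
  refine ⟨hf.sumElim (RelEmbedding.injective _) fun i j h => ?_, by simp [hn]⟩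
  have := Finset.orderEmbOfFin_mem _ hcard j
  rw [← h] at this
  simp at this

/-- Minors of `H` have degree at most `m ν`, and their coefficient there is the corresponding minor
of `H_ν`, which is nonzero for some columns because `H_ν` is surjective. -/
theorem maxMinorDegree_generator (hn : n = m + k) {H : Matrix (Fin m) (Fin n) F[X]} {ν : ℕ}
    (hdeg : ∀ i l, (H i l).natDegree ≤ ν)
    (hsurj : ∀ u : Fin m → F, ∃ w : Fin n → F, H.map (coeff · ν) *ᵥ w = u)
    {R : Matrix (Fin n) (Fin m) F[X]} (hR : H * R = 1) {C : Submodule F[X] (Fin n → F[X])}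
    (hC : IsParityCheckMatrix H C) {G : Matrix (Fin k) (Fin n) F[X]}
    (hG : IsGeneratorMatrix G C) : maxMinorDegree G = m * ν := by
  refine le_antisymm (Finset.sup_le fun t _ => ?_) ?_
  · obtain ⟨f, hf⟩ := exists_complement (hn.trans (add_comm m k)) t.injective
    have hf' : Function.Bijective (Sum.elim f t) := by
      have := hf.comp (Equiv.sumComm (Fin m) (Fin k)).bijective
      convert this using 1
      ext (i | i) <;> rfl
    rw [natDegree_det_generator hR hC hG f t hf']
    exact natDegree_det_le _ fun i j => hdeg _ _
  · obtain ⟨f, hf, hdet⟩ := exists_det_submatrix_ne_zero _ hsurj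
    obtain ⟨t, ht⟩ := exists_complement hn hf
    refine le_trans ?_ (Finset.le_sup (f := fun t : Fin k ↪o Fin n =>
      (G.submatrix id t).det.natDegree) (Finset.mem_univ t))
    rw [natDegree_det_generator hR hC hG f t ht]
    refine le_natDegree_of_ne_zero ?_
    rw [coeff_det_of_natDegree_le (H.submatrix id f) fun i j => hdeg _ _]
    exact hdet

/-! ### Rank, generator matrix and row degrees -/

theorem finrank_ker_of_right_inverse {H : Matrix (Fin m) (Fin n) F[X]}
    {R : Matrix (Fin n) (Fin m) F[X]} (hR : H * R = 1) :
    Module.finrank F[X] (LinearMap.ker H.mulVecLin) + m = n := by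
  have hsurj : Function.Surjective H.mulVecLin := fun y =>
    ⟨R *ᵥ y, by rw [Matrix.mulVecLin_apply, Matrix.mulVec_mulVec, hR, Matrix.one_mulVec]⟩
  have h := (LinearMap.ker H.mulVecLin).finrank_quotient_add_finrank
  rw [(H.mulVecLin.quotKerEquivOfSurjective hsurj).finrank_eq, Module.finrank_fin_fun,
    Module.finrank_fin_fun] at h
  omega

theorem exists_isGeneratorMatrix {C : Submodule F[X] (Fin n → F[X])}
    (hC : Module.finrank F[X] C = k) :
    ∃ G : Matrix (Fin k) (Fin n) F[X], IsGeneratorMatrix G C := by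
  let b := Module.finBasisOfFinrankEq F[X] C hC
  refine ⟨Matrix.of fun i => (b i : Fin n → F[X]), ?_, ?_⟩
  · exact b.linearIndependent.map' C.subtype C.ker_subtype
  · have h := congrArg (Submodule.map C.subtype) b.span_eq
    rw [Submodule.map_span, Submodule.map_top, Submodule.range_subtype, ← Set.range_comp] at h
    exact h

/-- Surjectivity of `H_ν` excludes a zero row, so each row reaches degree `ν`. -/
theorem rowDegree_eq {H : Matrix (Fin m) (Fin n) F[X]} {ν : ℕ}
    (hdeg : ∀ i l, (H i l).natDegree ≤ ν)
    (hsurj : ∀ u : Fin m → F, ∃ w : Fin n → F, H.map (coeff · ν) *ᵥ w = u) (i : Fin m) :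
    rowDegree H i = ν := by
  refine le_antisymm (Finset.sup_le fun l _ => hdeg i l) ?_
  obtain ⟨w, hw⟩ := hsurj 1
  have h : ∑ l, (H i l).coeff ν * w l ≠ 0 := by
    have : ∑ l, (H i l).coeff ν * w l = 1 := congrFun hw i
    rw [this]
    exact one_ne_zero
  obtain ⟨l, -, hl⟩ := Finset.exists_ne_zero_of_sum_ne_zero h
  exact (le_natDegree_of_ne_zero (left_ne_zero_of_mul hl)).trans
    (Finset.le_sup (f := fun l => (H i l).natDegree) (Finset.mem_univ l))

end ConvCode

/-! ### The main theorem -/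

theorem mainTheorem2 {F : Type*} [Field F] [Finite F] [DecidableEq F] (n k δ : ℕ)
    (hk : 0 < k) (hkn : k < n) (hdvd : (n - k) ∣ δ)
    (H : Matrix (Fin (n - k)) (Fin n) (Polynomial F))
    (hdeg : ∀ i l, (H i l).natDegree ≤ δ / (n - k))
    (hH : ConvCode.MinorCriterion H (δ / k + δ / (n - k))) :
    ConvCode.IsLeftPrime H ∧
      ∃ C : Submodule (Polynomial F) (Fin n → Polynomial F),
        ConvCode.IsParityCheckMatrix H C ∧ ConvCode.IsMDP n k δ C ∧
          δ = ∑ i, ConvCode.rowDegree H i := by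
  have hν : (n - k) * (δ / (n - k)) = δ := Nat.mul_div_cancel' hdvd
  -- After cancelling `(d + 1) m` this says `m ν = δ ≤ k (d + 1)`, which holds as `d = ⌊δ / k⌋`.
  have hle : (δ / k + δ / (n - k) + 1) * (n - k) ≤ (δ / k + 1) * n := by
    have h1 : δ < k * (δ / k + 1) := Nat.lt_mul_div_succ δ hk
    have h2 : (δ / k + 1) * n = (δ / k + 1) * (n - k) + k * (δ / k + 1) := by
      rw [mul_comm k, ← Nat.mul_add, Nat.sub_add_cancel hkn.le]
    have h3 : (δ / k + δ / (n - k) + 1) * (n - k) =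
        (δ / k + 1) * (n - k) + (n - k) * (δ / (n - k)) := by ring
    omega
  have hmn : n - k < n := by omega
  obtain ⟨R, hR⟩ := hH.exists_right_inverse hmn.le hle hdeg
  have hsurj := hH.exists_coeff_mulVec_eq hmn.le hle hdeg
  have hC : ConvCode.IsParityCheckMatrix H (LinearMap.ker H.mulVecLin) := fun c => by
    rw [LinearMap.mem_ker, Matrix.mulVecLin_apply]
  have hrank : Module.finrank (Polynomial F) (LinearMap.ker H.mulVecLin) = k := by
    have := ConvCode.finrank_ker_of_right_inverse hR
    omega
  refine ⟨ConvCode.isLeftPrime_of_right_inverse hR, LinearMap.ker H.mulVecLin, hC,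
    ⟨⟨hrank, ConvCode.exists_isGeneratorMatrix hrank, fun G hG => ?_⟩, fun j hj =>
      hH.columnDistance_eq hmn hj hR hC⟩, ?_⟩
  · rw [ConvCode.maxMinorDegree_generator (by omega) hdeg hsurj hR hC hG, hν]
  · simp only [ConvCode.rowDegree_eq hdeg hsurj]
    rw [Finset.sum_const, Finset.card_univ, Fintype.card_fin, smul_eq_mul, hν]
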